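/- For $n\ge 1$ let $B_n^+$ be the monoid of positive $n$-strand braids, presented by generators $\sigma_1,\dots,\sigma_{n-1}$ and relations $\sigma_i\sigma_j=\sigma_j\sigma_i$ for $|i-j|\ge 2$, $\sigma_i\sigma_j\sigma_i=\sigma_j\sigma_i\sigma_j$ for $|i-j|=1$. Put $\Delta_0=\Delta_1=1$ and $\Delta_m=\sigma_1\sigma_2\cdots\sigma_{m-1}\Delta_{m-1}$ for $2\le m\le n$. The left divisors of $\Delta_n$ in $B_n^+$ are called simple $n$-braids. A sequence $(x_1,\dots,x_d)$ of simple $n$-braids is called normal if, for each $k$, $x_k$ is the greatest common left divisor of $\Delta_n$ and $x_k x_{k+1}\cdots x_d$. Every positive $n$-braid is the product of a normal sequence, unique up to appending trivial factors $1$ on the right; extending this sequence by infinitely many $1$'s, its $d$th entry is called the $d$th factor of the braid, and the braid has degree at most $d$ if all its factors after the $d$th one are $1$. For $d\ge 1$ and $x$ a simple $n$-braid, let $b_{n,d}(x)$ be the number of positive $n$-braids of degree at most $d$ whose $d$th factor is $x$. **Proposition 4.4.** For $1\le r\le n$, $$b_{n,2}(\Delta_{n-r})=\frac{n!}{(n-r)!},$$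 and this number is also the number of simple $n$-braids $x$ that are right divisible by $\Delta_{n-r}$, i.e. of the form $x=z\,\Delta_{n-r}$ with $z\in B_n^+$. -/

import Mathlib

open scoped Nat

namespace BraidCount

/-- The defining relations of the monoid of positive `n`-strand braids. The letter `i : Fin (n - 1)`
stands for Artin's generator usually written `σ_{i+1}`. -/
inductive Rel (n : ℕ) : FreeMonoid (Fin (n - 1)) → FreeMonoid (Fin (n - 1)) → Prop
  | comm (i j : Fin (n - 1)) (h : (i : ℕ) + 2 ≤ j ∨ (j : ℕ) + 2 ≤ i) :
      Rel n (FreeMonoid.of i * FreeMonoid.of j) (FreeMonoid.of j * FreeMonoid.of i)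
  | braid (i j : Fin (n - 1)) (h : (i : ℕ) + 1 = j ∨ (j : ℕ) + 1 = i) :
      Rel n (FreeMonoid.of i * FreeMonoid.of j * FreeMonoid.of i)
        (FreeMonoid.of j * FreeMonoid.of i * FreeMonoid.of j)

/-- The monoid `B_n⁺` of positive `n`-strand braids. In this monoid Mathlib's divisibility
`x ∣ y` means `∃ z, y = x * z`, so it is left divisibility. -/
abbrev PosBraid (n : ℕ) : Type := PresentedMonoid (Rel n)

/-- The generator `σ_i` of `B_n⁺`, for `1 ≤ i ≤ n - 1`; it is only ever used for such `i`
(elsewhere the value is `1`). -/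
def sigma (n i : ℕ) : PosBraid n :=
  if h : 1 ≤ i ∧ i ≤ n - 1 then PresentedMonoid.of (Rel n) ⟨i - 1, by omega⟩ else 1

/-- The braid `Δ_m` seen in `B_n⁺`, for `m ≤ n`:
`Δ_0 = 1` and `Δ_{m+1} = σ_1 σ_2 ⋯ σ_m Δ_m` (so that `Δ_1 = 1`). -/
def Delta (n : ℕ) : ℕ → PosBraid n
  | 0 => 1
  | m + 1 => ((List.range m).map fun k => sigma n (k + 1)).prod * Delta n m

/-- Simple `n`-braids: the left divisors of `Δ_n` in `B_n⁺`. -/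
def IsSimple {n : ℕ} (x : PosBraid n) : Prop := x ∣ Delta n n

/-- `x` is right divisible by `y`. -/
def RightDivisibleBy {n : ℕ} (x y : PosBraid n) : Prop := ∃ z : PosBraid n, x = z * y

/-- `g` is the greatest common left divisor of `x` and `y`. -/
def IsLeftGcd {n : ℕ} (g x y : PosBraid n) : Prop :=
  g ∣ x ∧ g ∣ y ∧ ∀ z : PosBraid n, z ∣ x → z ∣ y → z ∣ g

/-- A finite sequence `(x_1, …, x_d)` of simple `n`-braids is normal if
`x_k = gcd(Δ_n, x_k ⋯ x_d)` for every `k`. -/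
def IsNormal {n : ℕ} (l : List (PosBraid n)) : Prop :=
  (∀ x ∈ l, IsSimple x) ∧
    ∀ (k : ℕ) (hk : k < l.length), IsLeftGcd l[k] (Delta n n) (l.drop k).prod

/-- `s` is the normal expression of the positive braid `y`, completed on the right by infinitely
many trivial factors. The factors are numbered from `0`: the `d`-th factor of `y` is `s (d - 1)`. -/
def IsNormalExpression {n : ℕ} (y : PosBraid n) (s : ℕ → PosBraid n) : Prop :=
  ∃ m : ℕ, IsNormal ((List.range m).map s) ∧ ((List.range m).map s).prod = y ∧
    ∀ k, m ≤ k → s k = 1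

/-- The set of positive `n`-braids of degree at most `d` (all factors of the normal expression
after the `d`-th one are trivial) whose `d`-th factor is `x`, for `d ≥ 1`. -/
def braidsWithFactor (n d : ℕ) (x : PosBraid n) : Set (PosBraid n) :=
  {y | ∃ s : ℕ → PosBraid n, IsNormalExpression y s ∧ (∀ k, d ≤ k → s k = 1) ∧ s (d - 1) = x}

/-- The number `b_{n,d}(x)`, for `d ≥ 1` and `x` a simple `n`-braid. -/
noncomputable def b (n d : ℕ) (x : PosBraid n) : ℕ := (braidsWithFactor n d x).ncard

end BraidCount

/-! Call a braid reduced if its length is the inversion number of its permutation. Reduced braids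
are exactly the simple ones (`isSimple_iff_reduced`), and each permutation lifts to exactly one of
them (`exists_reduced`, `Reduced.eq_of_perm_eq`), so simple braids can be counted as permutations.

The heart is `isLeftGcd_mul_Delta_iff`: for simple x, x is the gcd of Δ_n and xΔ_m iff x is right
divisible by Δ_m. If it is not, the permutation of x has an ascent i inside the first m positions;
then xσ_i is simple and divides xΔ_m, but is longer than x. For the converse, a monotone action of
braids on sets of pairs of strands, a Boolean form of the Lawrence–Krammer representation, detects
simple left divisors: it shows that those of xΔ_m already divide x. No general cancellation or lcm
theory is needed.

Right divisibility of a simple braid by Δ_m says that its permutation decreases on the first m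
positions. Such a permutation is determined by its values on the other r = n - m positions, which
may be any injective choice; hence n!/(n-r)!. -/

namespace BraidCount

open Equiv (Perm swap)

/-! ### Inversions of permutations and adjacent transpositions. -/

section Inversions

variable {n : ℕ}

/-- The ordered pairs of positions whose relative order is changed by `w`; both `(a, b)` and
`(b, a)` occur, so every inversion is counted twice. -/
def inversions (w : Perm (Fin n)) : Finset (Fin n × Fin n) :=
  Finset.univ.filter fun p => ¬ (p.1 < p.2 ↔ w p.1 < w p.2)

theorem mem_inversions {w : Perm (Fin n)} {p : Fin n × Fin n} :
    p ∈ inversions w ↔ ¬ (p.1 < p.2 ↔ w p.1 < w p.2) := by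
  simp [inversions]

theorem mem_inversions_mul {u v : Perm (Fin n)} {p : Fin n × Fin n} :
    p ∈ inversions (u * v) ↔ ¬ (p ∈ inversions v ↔ (v p.1, v p.2) ∈ inversions u) := by
  simp only [mem_inversions, Equiv.Perm.mul_apply]
  tauto

theorem ne_of_mem_inversions {w : Perm (Fin n)} {p : Fin n × Fin n} (h : p ∈ inversions w) :
    p.1 ≠ p.2 := by
  intro e
  simp [mem_inversions, e] at h

theorem card_inversions_eq_card_filter (u v : Perm (Fin n)) :
    (inversions u).card =
      (Finset.univ.filter fun p : Fin n × Fin n => (v p.1, v p.2) ∈ inversions u).card := by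
  symm
  refine Finset.card_bij (fun p _ => (v p.1, v p.2)) ?_ ?_ ?_
  · intro p hp
    simpa using hp
  · rintro ⟨a, b⟩ _ ⟨c, d⟩ _ h
    simpa using h
  · rintro ⟨a, b⟩ h
    exact ⟨(v⁻¹ a, v⁻¹ b), by simpa using h, by simp⟩

/-- The inversions of `u * v` are the symmetric difference of those of `v` and of the pairs that `v`
carries to inversions of `u`; a pair in both is reversed twice and drops out of both counts. -/
theorem card_inversions_mul (u v : Perm (Fin n)) :
    (inversions (u * v)).card +
        2 * ((inversions v).filter fun p => (v p.1, v p.2) ∈ inversions u).card =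
      (inversions u).card + (inversions v).card := by
  have h1 : ((inversions v).filter fun p => (v p.1, v p.2) ∈ inversions u).card =
      ∑ p : Fin n × Fin n, if p ∈ inversions v ∧ (v p.1, v p.2) ∈ inversions u then 1 else 0 := by
    rw [← Finset.card_filter]
    congr 1
    ext p
    simp
  have h2 (w : Perm (Fin n)) : (inversions w).card =
      ∑ p : Fin n × Fin n, if p ∈ inversions w then 1 else 0 := by
    rw [← Finset.card_filter]
    simp
  rw [card_inversions_eq_card_filter u v, h1, h2 (u * v), h2 v, Finset.card_filter,
    Finset.mul_sum, ← Finset.sum_add_distrib, ← Finset.sum_add_distrib]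
  refine Finset.sum_congr rfl fun p _ => ?_
  simp only [mem_inversions_mul]
  by_cases h3 : p ∈ inversions v <;> by_cases h4 : (v p.1, v p.2) ∈ inversions u <;> simp [h3, h4]

theorem card_inversions_mul_le (u v : Perm (Fin n)) :
    (inversions (u * v)).card ≤ (inversions u).card + (inversions v).card := by
  have := card_inversions_mul u v
  omega

theorem card_inversions_mul_eq_iff (u v : Perm (Fin n)) :
    (inversions (u * v)).card = (inversions u).card + (inversions v).card ↔
      inversions v ⊆ inversions (u * v) := by
  have h := card_inversions_mul u v
  have h' : (inversions (u * v)).card = (inversions u).card + (inversions v).card ↔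
      ((inversions v).filter fun p => (v p.1, v p.2) ∈ inversions u).card = 0 := by omega
  rw [h', Finset.card_eq_zero, Finset.filter_eq_empty_iff]
  refine forall_congr' fun p => ?_
  rw [mem_inversions_mul]
  tauto

/-- The lower of the two positions exchanged by the `i`-th adjacent transposition. -/
def lo (i : Fin (n - 1)) : Fin n := ⟨i, by omega⟩

/-- The upper of the two positions exchanged by the `i`-th adjacent transposition. -/
def hi (i : Fin (n - 1)) : Fin n := ⟨i + 1, by omega⟩

@[simp] theorem lo_val (i : Fin (n - 1)) : (lo i : ℕ) = i := rfl

@[simp] theorem hi_val (i : Fin (n - 1)) : (hi i : ℕ) = i + 1 := rfl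

/-- The `i`-th adjacent transposition. -/
def adj (i : Fin (n - 1)) : Perm (Fin n) := swap (lo i) (hi i)

@[simp] theorem adj_mul_self (i : Fin (n - 1)) : adj i * adj i = 1 := Equiv.swap_mul_self _ _

@[simp] theorem adj_inv (i : Fin (n - 1)) : (adj i)⁻¹ = adj i := Equiv.swap_inv _ _

theorem adj_apply_val (i : Fin (n - 1)) (a : Fin n) :
    (adj i a : ℕ) = if (a : ℕ) = i then (i : ℕ) + 1 else if (a : ℕ) = i + 1 then (i : ℕ) else a := by
  rw [adj, Equiv.swap_apply_def]
  simp only [Fin.ext_iff, lo_val, hi_val]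
  split_ifs <;> simp

theorem adj_lo (i : Fin (n - 1)) : adj i (lo i) = hi i := Equiv.swap_apply_left _ _

theorem adj_hi (i : Fin (n - 1)) : adj i (hi i) = lo i := Equiv.swap_apply_right _ _

theorem lo_lt_hi (i : Fin (n - 1)) : lo i < hi i := by
  rw [Fin.lt_def]
  simp

theorem inversions_adj (i : Fin (n - 1)) : inversions (adj i) = {(lo i, hi i), (hi i, lo i)} := by
  ext ⟨a, b⟩
  simp only [mem_inversions, Finset.mem_insert, Finset.mem_singleton, Prod.mk.injEq, Fin.lt_def,
    Fin.ext_iff, adj_apply_val, lo_val, hi_val]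
  split_ifs <;> omega

theorem card_inversions_adj (i : Fin (n - 1)) : (inversions (adj i)).card = 2 := by
  rw [inversions_adj, Finset.card_pair]
  simp [(lo_lt_hi i).ne]

theorem card_inversions_mul_adj (w : Perm (Fin n)) (i : Fin (n - 1)) (h : w (lo i) < w (hi i)) :
    (inversions (w * adj i)).card = (inversions w).card + 2 := by
  rw [← card_inversions_adj i, card_inversions_mul_eq_iff, inversions_adj]
  have := lo_lt_hi i
  intro p hp
  simp only [Finset.mem_insert, Finset.mem_singleton] at hp
  rcases hp with rfl | rfl <;>
    simp [mem_inversions, adj_lo, adj_hi, h, h.le, this, this.le]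

theorem card_inversions_of_descent (w : Perm (Fin n)) (i : Fin (n - 1)) (h : w (hi i) < w (lo i)) :
    (inversions w).card = (inversions (w * adj i)).card + 2 := by
  rw [← card_inversions_mul_adj, mul_assoc, adj_mul_self, mul_one]
  simpa [adj_lo, adj_hi] using h

theorem exists_descent (w : Perm (Fin n)) (h : w ≠ 1) : ∃ i, w (hi i) < w (lo i) := by
  by_contra! hc
  apply h
  have hm : StrictMono w := by
    cases n with
    | zero => exact fun a => a.elim0
    | succ m =>
      rw [Fin.strictMono_iff_lt_succ]
      intro i
      refine lt_of_le_of_ne (hc i) fun e => ?_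
      simpa [Fin.ext_iff] using w.injective e
  have := (hm.range_inj strictMono_id).1 (by simp [w.surjective.range_eq])
  ext a
  simp [this]

theorem inversions_one : inversions (1 : Perm (Fin n)) = ∅ := by
  ext p
  simp [mem_inversions]

end Inversions

/-! ### Reduced braids and Matsumoto's theorem. -/

section Braids

variable {n : ℕ}

/-- The generators of the braid monoid, numbered from `0`. -/
def gen (i : Fin (n - 1)) : PosBraid n := PresentedMonoid.of (Rel n) i

theorem gen_comm (i j : Fin (n - 1)) (h : (i : ℕ) + 2 ≤ j ∨ (j : ℕ) + 2 ≤ i) :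
    gen i * gen j = gen j * gen i :=
  PresentedMonoid.mk_eq_mk_of_rel (Rel.comm i j h)

theorem gen_braid (i j : Fin (n - 1)) (h : (i : ℕ) + 1 = j ∨ (j : ℕ) + 1 = i) :
    gen i * gen j * gen i = gen j * gen i * gen j :=
  PresentedMonoid.mk_eq_mk_of_rel (Rel.braid i j h)

theorem adj_comm (i j : Fin (n - 1)) (h : (i : ℕ) + 2 ≤ j ∨ (j : ℕ) + 2 ≤ i) :
    adj i * adj j = adj j * adj i := by
  ext a
  simp only [Perm.mul_apply, adj_apply_val]
  split_ifs <;> omega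

theorem adj_braid (i j : Fin (n - 1)) (h : (i : ℕ) + 1 = j ∨ (j : ℕ) + 1 = i) :
    adj i * adj j * adj i = adj j * adj i * adj j := by
  wlog h' : (i : ℕ) + 1 = j generalizing i j
  · exact (this j i h.symm (h.resolve_left h')).symm
  ext a
  simp only [Perm.mul_apply, adj_apply_val, ← h']
  have e1 : ¬ (i : ℕ) + 1 + 1 = i := by omega
  have e2 : ¬ (i : ℕ) = i + 1 + 1 := by omega
  by_cases h1 : (a : ℕ) = i
  · simp [h1, e1, e2]
  by_cases h2 : (a : ℕ) = i + 1
  · simp [h2, e1, e2]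
  by_cases h3 : (a : ℕ) = i + 1 + 1
  · simp [h3, e1, e2]
  simp [h1, h2, h3]

/-- The permutation of a positive braid. -/
def perm : PosBraid n →* Perm (Fin n) :=
  PresentedMonoid.lift adj (by
    rintro _ _ (⟨i, j, h⟩ | ⟨i, j, h⟩)
    · simpa using adj_comm i j h
    · simpa using adj_braid i j h)

/-- The number of crossings of a positive braid. -/
def lenHom : PosBraid n →* Multiplicative ℕ :=
  PresentedMonoid.lift (fun _ => Multiplicative.ofAdd 1) (by
    rintro _ _ (⟨i, j, h⟩ | ⟨i, j, h⟩) <;> simp)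

/-- The number of crossings of a positive braid. -/
def len (x : PosBraid n) : ℕ := (lenHom x).toAdd

@[simp] theorem perm_gen (i : Fin (n - 1)) : perm (gen i) = adj i := rfl

@[simp] theorem len_gen (i : Fin (n - 1)) : len (gen i) = 1 := rfl

@[simp] theorem len_one : len (1 : PosBraid n) = 0 := by simp [len]

@[simp] theorem len_mul (x y : PosBraid n) : len (x * y) = len x + len y := by simp [len]

theorem eq_one_or_eq_mul_gen (x : PosBraid n) : x = 1 ∨ ∃ y i, x = y * gen i := by
  have : x ∈ Submonoid.closure (Set.range (PresentedMonoid.of (Rel n))) := by simp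
  induction this using Submonoid.closure_induction_right with
  | one => exact Or.inl rfl
  | mul_right y _ z hz _ =>
    obtain ⟨i, rfl⟩ := hz
    exact Or.inr ⟨y, i, rfl⟩

theorem eq_one_or_eq_gen_mul (x : PosBraid n) : x = 1 ∨ ∃ y i, x = gen i * y := by
  have : x ∈ Submonoid.closure (Set.range (PresentedMonoid.of (Rel n))) := by simp
  induction this using Submonoid.closure_induction_left with
  | one => exact Or.inl rfl
  | mul_left z hz y _ _ =>
    obtain ⟨i, rfl⟩ := hz
    exact Or.inr ⟨y, i, rfl⟩

theorem eq_one_of_len_eq_zero {x : PosBraid n} (h : len x = 0) : x = 1 := by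
  rcases eq_one_or_eq_mul_gen x with rfl | ⟨y, i, rfl⟩
  · rfl
  · simp at h

theorem dvd_antisymm_posBraid {x y : PosBraid n} (h : x ∣ y) (h' : y ∣ x) : x = y := by
  obtain ⟨a, rfl⟩ := h
  obtain ⟨b, hb⟩ := h'
  have := congrArg len hb
  simp only [len_mul] at this
  rw [eq_one_of_len_eq_zero (x := a) (by omega), mul_one]

theorem card_inversions_perm_le (x : PosBraid n) : (inversions (perm x)).card ≤ 2 * len x := by
  induction h : len x generalizing x with
  | zero => simp [eq_one_of_len_eq_zero h, inversions_one]
  | succ k ih =>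
    rcases eq_one_or_eq_mul_gen x with rfl | ⟨y, i, rfl⟩
    · simp at h
    · have h1 := ih y (by simpa using h)
      have h2 := card_inversions_mul_le (perm y) (adj i)
      rw [card_inversions_adj] at h2
      rw [map_mul, perm_gen]
      omega

/-- A positive braid is reduced if any two strands cross at most once. -/
def Reduced (x : PosBraid n) : Prop := (inversions (perm x)).card = 2 * len x

theorem reduced_one : Reduced (1 : PosBraid n) := by
  simp [Reduced, inversions_one]

/-- Inversion number is subadditive and bounded by length, so equality for the product forces
equality in every intermediate bound. -/
theorem Reduced.of_mul {x y : PosBraid n} (h : Reduced (x * y)) :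
    Reduced x ∧ Reduced y ∧ inversions (perm y) ⊆ inversions (perm x * perm y) := by
  have h1 := card_inversions_perm_le x
  have h2 := card_inversions_perm_le y
  have h3 := card_inversions_mul_le (perm x) (perm y)
  rw [Reduced, map_mul, len_mul] at h
  refine ⟨?_, ?_, ?_⟩
  · rw [Reduced]
    omega
  · rw [Reduced]
    omega
  · rw [← card_inversions_mul_eq_iff]
    omega

theorem Reduced.mul {x y : PosBraid n} (hx : Reduced x) (hy : Reduced y)
    (h : inversions (perm y) ⊆ inversions (perm x * perm y)) : Reduced (x * y) := by
  rw [← card_inversions_mul_eq_iff] at h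
  rw [Reduced] at *
  rw [map_mul, h, hx, hy, len_mul]
  ring

theorem Reduced.mul_gen {x : PosBraid n} (hx : Reduced x) {i : Fin (n - 1)}
    (h : perm x (lo i) < perm x (hi i)) : Reduced (x * gen i) := by
  have := card_inversions_mul_adj _ _ h
  rw [Reduced] at *
  rw [map_mul, perm_gen, this, hx, len_mul, len_gen]
  ring

theorem Reduced.lt_of_mul_gen {x : PosBraid n} {i : Fin (n - 1)} (h : Reduced (x * gen i)) :
    perm x (lo i) < perm x (hi i) := by
  by_contra hc
  have h1 := card_inversions_perm_le x
  have h2 : perm x (hi i) < perm x (lo i) :=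
    lt_of_le_of_ne (not_lt.1 hc) fun e => (lo_lt_hi i).ne' ((perm x).injective e)
  have h3 := card_inversions_of_descent _ _ h2
  rw [Reduced, map_mul, perm_gen, len_mul, len_gen] at h
  omega

/-- Bubble sort: each descent removed supplies one generator and lowers the doubled inversion count
by two. -/
theorem exists_reduced (w : Perm (Fin n)) : ∃ x : PosBraid n, Reduced x ∧ perm x = w := by
  induction h : (inversions w).card using Nat.strong_induction_on generalizing w with
  | _ k ih =>
    by_cases hw : w = 1
    · exact ⟨1, reduced_one, by simp [hw]⟩
    · obtain ⟨i, hi'⟩ := exists_descent w hw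
      have h1 := card_inversions_of_descent w i hi'
      obtain ⟨x, hx, hxw⟩ := ih _ (by omega) (w * adj i) rfl
      refine ⟨x * gen i, hx.mul_gen ?_, ?_⟩
      · simpa [hxw, adj_lo, adj_hi] using hi'
      · rw [map_mul, hxw, perm_gen, mul_assoc, adj_mul_self, mul_one]

theorem adj_lo_of_far {i j : Fin (n - 1)} (h : (i : ℕ) + 2 ≤ j ∨ (j : ℕ) + 2 ≤ i) :
    adj j (lo i) = lo i ∧ adj j (hi i) = hi i := by
  constructor <;> ext <;> grind [adj_apply_val, lo_val, hi_val]

theorem adj_of_succ {i j : Fin (n - 1)} (h : (i : ℕ) + 1 = j) :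
    lo j = hi i ∧ adj j (lo i) = lo i ∧ adj j (hi i) = hi j ∧ adj i (hi j) = hi j := by
  refine ⟨?_, ?_, ?_, ?_⟩ <;> ext <;> grind [adj_apply_val, lo_val, hi_val]

/-- Two reduced braids with the same permutation, ending with generators `i` and `j`, are equal
as soon as shorter reduced braids are determined by their permutations. -/
theorem mul_gen_eq_of_reduced {k : ℕ}
    (ih : ∀ x y : PosBraid n, len x = k → Reduced x → Reduced y → perm x = perm y → x = y)
    {x y : PosBraid n} {i j : Fin (n - 1)} (hij : i ≤ j) (hx : len x = k) (hy : len y = k)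
    (hxi : Reduced (x * gen i)) (hyj : Reduced (y * gen j))
    (hxy : perm x * adj i = perm y * adj j) : x * gen i = y * gen j := by
  have lti := hxi.lt_of_mul_gen
  have ltj := hyj.lt_of_mul_gen
  have rx := hxi.of_mul.1
  have ry := hyj.of_mul.1
  have hpy : perm y = perm x * adj i * adj j := by
    rw [hxy, mul_assoc, adj_mul_self, mul_one]
  rcases eq_or_lt_of_le hij with rfl | hlt
  · rw [ih x y hx rx ry (by simpa using hxy)]
  rw [Fin.lt_def] at hlt
  simp only [hpy, Perm.mul_apply, adj_lo, adj_hi] at ltj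
  rcases Nat.lt_or_ge ((i : ℕ) + 1) j with hfar | hnear
  · obtain ⟨f1, f2⟩ := adj_lo_of_far (i := i) (j := j) (Or.inl hfar)
    obtain ⟨f3, f4⟩ := adj_lo_of_far (i := j) (j := i) (Or.inr hfar)
    rw [f3, f4] at ltj
    -- Both words pass through one braid `c`: the target is x = cσ_j and y = cσ_i, so that
    -- commutation finishes.
    obtain ⟨c, hc, hcw⟩ := exists_reduced (perm x * adj j)
    have e1 : x = c * gen j := by
      refine ih _ _ hx rx (hc.mul_gen ?_) ?_
      · simpa [hcw, adj_lo, adj_hi] using ltj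
      · rw [map_mul, hcw, perm_gen, mul_assoc, adj_mul_self, mul_one]
    have e2 : y = c * gen i := by
      refine ih _ _ hy ry (hc.mul_gen ?_) ?_
      · simpa [hcw, f1, f2] using lti
      · rw [map_mul, hcw, perm_gen, hpy, mul_assoc, mul_assoc, adj_comm i j (Or.inl hfar)]
    rw [e1, e2, mul_assoc, mul_assoc, gen_comm i j (Or.inl hfar)]
  · have hs : (i : ℕ) + 1 = j := by omega
    obtain ⟨f1, f2, f3, f4⟩ := adj_of_succ hs
    rw [f1, f4, adj_hi] at ltj
    have hb := adj_braid i j (Or.inl hs)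
    -- Here the target is x = cσ_iσ_j and y = cσ_jσ_i, so that the braid relation finishes.
    obtain ⟨c, hc, hcw⟩ := exists_reduced (perm x * adj j * adj i)
    have c1 : perm c (lo i) = perm x (hi j) := by simp [hcw, adj_lo, f3]
    have c2 : perm c (hi i) = perm x (lo i) := by simp [hcw, adj_hi, f2]
    have c3 : perm c (hi j) = perm x (hi i) := by simp [hcw, f4, adj_hi, ← f1]
    have e1 : x = c * gen i * gen j := by
      refine ih _ _ hx rx ((hc.mul_gen ?_).mul_gen ?_) ?_
      · rwa [c1, c2]
      · simpa [f1, f4, adj_hi, c1, c3] using ltj.trans lti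
      · simp only [map_mul, hcw, perm_gen]
        rw [mul_assoc _ (adj i) (adj i), adj_mul_self, mul_one, mul_assoc, adj_mul_self, mul_one]
    have e2 : y = c * gen j * gen i := by
      refine ih _ _ hy ry ((hc.mul_gen ?_).mul_gen ?_) ?_
      · rwa [f1, c2, c3]
      · simpa [f2, f3, c1, c3] using ltj.trans lti
      · simp only [map_mul, hcw, perm_gen, hpy]
        have : adj j * adj i * adj j * adj i = adj i * adj j := by
          rw [← hb, mul_assoc, adj_mul_self, mul_one]
        simp only [mul_assoc] at this ⊢
        rw [this]
    have := gen_braid i j (Or.inl hs)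
    rw [e1, e2]
    simp only [mul_assoc] at this ⊢
    rw [← this]

/-- Matsumoto's theorem for braids: a reduced braid is determined by its permutation. -/
theorem Reduced.eq_of_perm_eq {x y : PosBraid n} (hx : Reduced x) (hy : Reduced y)
    (h : perm x = perm y) : x = y := by
  induction hk : len x generalizing x y with
  | zero =>
    have h1 : 2 * len x = 2 * len y := by rw [← hx, ← hy, h]
    rw [eq_one_of_len_eq_zero hk, eq_one_of_len_eq_zero (x := y) (by omega)]
  | succ k ih =>
    have h1 : 2 * len x = 2 * len y := by rw [← hx, ← hy, h]
    rcases eq_one_or_eq_mul_gen x with rfl | ⟨x, i, rfl⟩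
    · simp at hk
    rcases eq_one_or_eq_mul_gen y with rfl | ⟨y, j, rfl⟩
    · simp at h1
    simp only [len_mul, len_gen] at hk h1
    have ih' : ∀ x y : PosBraid n, len x = k → Reduced x → Reduced y → perm x = perm y → x = y :=
      fun x y h1 h2 h3 h4 => ih h2 h3 h4 h1
    simp only [map_mul, perm_gen] at h
    rcases le_total i j with hij | hij
    · exact mul_gen_eq_of_reduced ih' hij (by omega) (by omega) hx hy h
    · exact (mul_gen_eq_of_reduced ih' hij (by omega) (by omega) hy hx h.symm).symm

end Braids

/-! ### A Boolean Krammer action that detects simple left divisors. -/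

section Krammer

variable {n : ℕ}

/-- The action of the `i`-th generator on sets of pairs `a < b` of strands: the Lawrence–Krammer
matrix of the generator, reduced to the Boolean semiring at `t = 0`. -/
def krammerGen (i : Fin (n - 1)) (P : Fin n → Fin n → Prop) (a b : Fin n) : Prop :=
  a < b ∧ ¬ (a = lo i ∧ b = hi i) ∧
    (P (adj i a) (adj i b) ∨ ((b = lo i ∨ a = hi i) ∧ P a b))

theorem adj_of_ne {i : Fin (n - 1)} {a : Fin n} (h1 : a ≠ lo i) (h2 : a ≠ hi i) : adj i a = a :=
  Equiv.swap_apply_of_ne_of_ne h1 h2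

/-- The case split behind the relations for `krammerGen`: a strand outside the exchanged two is
fixed and lies on the same side of both, which leaves finitely many configurations. -/
theorem eq_lo_or_eq_hi_or (i : Fin (n - 1)) (c : Fin n) : c = lo i ∨ c = hi i ∨
    (c ≠ lo i ∧ c ≠ hi i ∧ adj i c = c ∧ (c < lo i ↔ c < hi i) ∧ (lo i < c ↔ hi i < c)) := by
  by_cases h1 : c = lo i
  · exact Or.inl h1
  by_cases h2 : c = hi i
  · exact Or.inr (Or.inl h2)
  refine Or.inr (Or.inr ⟨h1, h2, adj_of_ne h1 h2, ?_⟩)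
  simp only [Fin.lt_def, Fin.ext_iff, lo_val, hi_val] at *
  omega

theorem krammerGen_comm (i j : Fin (n - 1)) (h : (i : ℕ) + 2 ≤ j ∨ (j : ℕ) + 2 ≤ i)
    (P : Fin n → Fin n → Prop) :
    krammerGen i (krammerGen j P) = krammerGen j (krammerGen i P) := by
  obtain ⟨f1, f2⟩ := adj_lo_of_far h
  obtain ⟨f3, f4⟩ := adj_lo_of_far h.symm
  have d1 := adj_lo i
  have d2 := adj_hi i
  have d3 := adj_lo j
  have d4 := adj_hi j
  have l1 := lo_lt_hi i
  have l2 := lo_lt_hi j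
  have n1 : lo i ≠ lo j := by rw [Ne, Fin.ext_iff]; simp only [lo_val]; omega
  have n2 : lo i ≠ hi j := by rw [Ne, Fin.ext_iff]; simp only [lo_val, hi_val]; omega
  have n3 : hi i ≠ lo j := by rw [Ne, Fin.ext_iff]; simp only [lo_val, hi_val]; omega
  have n4 : hi i ≠ hi j := by rw [Ne, Fin.ext_iff]; simp only [hi_val]; omega
  funext a b
  apply propext
  unfold krammerGen
  rcases eq_lo_or_eq_hi_or i a with ha | ha | ha <;>
  rcases eq_lo_or_eq_hi_or j a with ha' | ha' | ha' <;>
  rcases eq_lo_or_eq_hi_or i b with hb | hb | hb <;>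
  rcases eq_lo_or_eq_hi_or j b with hb' | hb' | hb' <;>
  grind

theorem krammerGen_braid (i j : Fin (n - 1)) (h : (i : ℕ) + 1 = j ∨ (j : ℕ) + 1 = i)
    (P : Fin n → Fin n → Prop) :
    krammerGen i (krammerGen j (krammerGen i P)) = krammerGen j (krammerGen i (krammerGen j P)) := by
  wlog h' : (i : ℕ) + 1 = j generalizing i j
  · exact (this j i h.symm (h.resolve_left h')).symm
  obtain ⟨f1, f2, f3, f4⟩ := adj_of_succ h'
  have d1 : adj i (lo i) = hi i := adj_lo i
  have d2 : adj i (hi i) = lo i := adj_hi i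
  have d3 : adj j (hi j) = hi i := by rw [← f1]; exact adj_hi j
  have l1 : lo i < hi i := lo_lt_hi i
  have l2 : hi i < hi j := f1 ▸ lo_lt_hi j
  have l3 := l1.trans l2
  funext a b
  apply propext
  unfold krammerGen
  rcases eq_lo_or_eq_hi_or i a with ha | ha | ha <;>
  rcases eq_lo_or_eq_hi_or j a with ha' | ha' | ha' <;>
  rcases eq_lo_or_eq_hi_or i b with hb | hb | hb <;>
  rcases eq_lo_or_eq_hi_or j b with hb' | hb' | hb' <;>
  grind

/-- The action of positive braids on sets of pairs of strands. -/
def krammer : PosBraid n →* Function.End (Fin n → Fin n → Prop) :=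
  PresentedMonoid.lift (M := Function.End (Fin n → Fin n → Prop)) krammerGen (by
    rintro _ _ (⟨i, j, h⟩ | ⟨i, j, h⟩) <;> funext P
    · exact krammerGen_comm i j h P
    · exact krammerGen_braid i j h P)

theorem krammer_gen (i : Fin (n - 1)) (P : Fin n → Fin n → Prop) :
    krammer (gen i) P = krammerGen i P := rfl

theorem krammer_one (P : Fin n → Fin n → Prop) : krammer 1 P = P := by
  rw [map_one]
  rfl

theorem krammer_mul (x y : PosBraid n) (P : Fin n → Fin n → Prop) :
    krammer (x * y) P = krammer x (krammer y P) := by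
  rw [map_mul]
  rfl

theorem krammerGen_mono (i : Fin (n - 1)) : Monotone (krammerGen i) := by
  intro P Q h a b
  rintro ⟨h1, h2, h3⟩
  exact ⟨h1, h2, h3.imp (h _ _) (And.imp_right (h _ _))⟩

theorem krammer_mono (x : PosBraid n) : Monotone (krammer x) := by
  have : x ∈ Submonoid.closure (Set.range (PresentedMonoid.of (Rel n))) := by simp
  induction this using Submonoid.closure_induction with
  | mem x hx =>
    obtain ⟨i, rfl⟩ := hx
    exact krammerGen_mono i
  | one =>
    intro P Q h
    simpa only [krammer_one] using h
  | mul x y _ _ hx hy =>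
    intro P Q h
    simpa only [krammer_mul] using hx (hy h)

theorem krammer_lt_le (x : PosBraid n) : krammer x (· < ·) ≤ (· < ·) := by
  rcases eq_one_or_eq_gen_mul x with rfl | ⟨y, i, rfl⟩
  · rw [krammer_one]
  · rw [krammer_mul]
    exact fun a b h => h.1

/-- The pairs `a < b` of strands that do not cross in the simple braid of permutation `w`. -/
def Uncrossed (w : Perm (Fin n)) (a b : Fin n) : Prop := a < b ∧ w⁻¹ a < w⁻¹ b

theorem krammerGen_uncrossed {i : Fin (n - 1)} {w : Perm (Fin n)} (h : w⁻¹ (lo i) < w⁻¹ (hi i)) :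
    krammerGen i (Uncrossed w) = Uncrossed (adj i * w) := by
  have d1 := adj_lo i
  have d2 := adj_hi i
  have l1 := lo_lt_hi i
  funext a b
  apply propext
  simp only [krammerGen, Uncrossed, mul_inv_rev, adj_inv, Perm.mul_apply]
  generalize (w⁻¹ : Perm (Fin n)) = v at h
  rcases eq_lo_or_eq_hi_or i a with ha | ha | ha <;>
  rcases eq_lo_or_eq_hi_or i b with hb | hb | hb <;>
  grind

/-- Otherwise the two strands crossed by the generator would already cross in `x`, and so cross
twice. -/
theorem Reduced.lt_of_gen_mul {x : PosBraid n} {i : Fin (n - 1)} (h : Reduced (gen i * x)) :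
    (perm x)⁻¹ (lo i) < (perm x)⁻¹ (hi i) := by
  have e (a : Fin n) : perm x ((perm x)⁻¹ a) = a := Equiv.apply_symm_apply _ a
  by_contra hc
  have hlt : (perm x)⁻¹ (hi i) < (perm x)⁻¹ (lo i) :=
    lt_of_le_of_ne (not_lt.1 hc) fun e => (lo_lt_hi i).ne' ((perm x)⁻¹.injective e)
  have h1 := lo_lt_hi i
  have h2 : ((perm x)⁻¹ (hi i), (perm x)⁻¹ (lo i)) ∈ inversions (perm x) := by
    rw [mem_inversions]
    simp only [hlt, true_iff, e, h1.not_gt, not_false_iff]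
  have h3 := h.of_mul.2.2 h2
  simp only [mem_inversions, Perm.mul_apply, perm_gen, e, adj_lo, adj_hi, hlt, h1,
    not_true] at h3

theorem Reduced.krammer_lt {x : PosBraid n} (hx : Reduced x) :
    krammer x (· < ·) = Uncrossed (perm x) := by
  induction h : len x generalizing x with
  | zero =>
    rw [eq_one_of_len_eq_zero h, krammer_one, map_one]
    funext a b
    simp [Uncrossed]
  | succ k ih =>
    rcases eq_one_or_eq_gen_mul x with rfl | ⟨y, i, rfl⟩
    · simp at h
    · rw [len_mul, len_gen, add_comm] at h
      rw [krammer_mul, ih hx.of_mul.2.1 (by omega), krammer_gen,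
        krammerGen_uncrossed hx.lt_of_gen_mul, map_mul, perm_gen]

/-- With y = xz, the factor z can only shrink the full set of pairs, and x acts monotonically. Here
`y` need not be simple, which is what allows y = xΔ_m later. -/
theorem Reduced.krammer_le_uncrossed {x y : PosBraid n} (hx : Reduced x) (h : x ∣ y) :
    krammer y (· < ·) ≤ Uncrossed (perm x) := by
  obtain ⟨z, rfl⟩ := h
  rw [krammer_mul, ← hx.krammer_lt]
  exact krammer_mono x (krammer_lt_le z)

/-- The quotient permutation lifts to a reduced `z`. A pair inverted by `z` but not by `y` would be
uncrossed in `y`, hence in `x`, and so could not be inverted by `z`; thus `x * z` is reduced. -/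
theorem Reduced.dvd_of_uncrossed_le {x y : PosBraid n} (hx : Reduced x) (hy : Reduced y)
    (h : Uncrossed (perm y) ≤ Uncrossed (perm x)) : x ∣ y := by
  obtain ⟨z, hz, hzw⟩ := exists_reduced ((perm x)⁻¹ * perm y)
  refine ⟨z, hy.eq_of_perm_eq (hx.mul hz ?_) (by simp [hzw])⟩
  rintro ⟨a, b⟩ hp
  have e (a : Fin n) : (perm y)⁻¹ (perm y a) = a := Equiv.symm_apply_apply _ a
  have h1 := h (perm y a) (perm y b)
  have h2 := h (perm y b) (perm y a)
  have h3 := ne_of_mem_inversions hp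
  have h4 : perm y a ≠ perm y b := (perm y).injective.ne h3
  have h5 : (perm x)⁻¹ (perm y a) ≠ (perm x)⁻¹ (perm y b) := (perm x)⁻¹.injective.ne h4
  simp only [Uncrossed, e] at h1 h2
  simp only [hzw, mul_inv_cancel_left, mem_inversions, Perm.mul_apply] at hp ⊢
  simp only [le_Prop_eq] at h1 h2
  grind

/-- The pairs of strands whose upper strand is not among the first `m`. -/
def Outer (m : ℕ) (a b : Fin n) : Prop := a < b ∧ m ≤ b

/-- Such a generator only moves the first m strands, so it fixes the upper strand of an outer pair
and keeps the lower one below it. -/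
theorem outer_le_krammerGen {m : ℕ} {i : Fin (n - 1)} (h : (i : ℕ) + 1 < m) :
    (Outer m : Fin n → Fin n → Prop) ≤ krammerGen i (Outer m) := by
  intro a b ⟨h1, h2⟩
  have hb : adj i b = b := adj_of_ne (by rw [Ne, Fin.ext_iff]; simp; omega)
    (by rw [Ne, Fin.ext_iff]; simp; omega)
  have ha := adj_apply_val i a
  refine ⟨h1, ?_, Or.inl ⟨?_, ?_⟩⟩
  · rintro ⟨rfl, rfl⟩
    simp at h2
    omega
  · rw [hb, Fin.lt_def, ha]
    rw [Fin.lt_def] at h1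
    split_ifs <;> omega
  · rwa [hb]

end Krammer

/-! ### The braids Δ_m: permutation, divisors, and the normality criterion. -/

section Garside

variable {n : ℕ}

theorem sigma_succ {k : ℕ} (h : k < n - 1) : sigma n (k + 1) = gen ⟨k, h⟩ := by
  rw [sigma, dif_pos ⟨by omega, by omega⟩]
  rfl

theorem Delta_succ (m : ℕ) : Delta n (m + 1) =
    ((List.range m).map fun k => sigma n (k + 1)).prod * Delta n m := rfl

theorem prod_sigma_succ {m : ℕ} (h : m < n - 1) :
    ((List.range (m + 1)).map fun k => sigma n (k + 1)).prod =
      ((List.range m).map fun k => sigma n (k + 1)).prod * gen ⟨m, h⟩ := by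
  rw [List.range_succ, List.map_append, List.prod_append, List.map_singleton, List.prod_singleton,
    sigma_succ h]

theorem Delta_mem (S : Submonoid (PosBraid n)) {m : ℕ} (hm : m ≤ n)
    (h : ∀ i : Fin (n - 1), (i : ℕ) + 1 < m → gen i ∈ S) : Delta n m ∈ S := by
  induction m with
  | zero => exact S.one_mem
  | succ m ih =>
    refine S.mul_mem (S.list_prod_mem fun y hy => ?_) (ih (by omega) fun i hi' => h i (by omega))
    obtain ⟨k, hk, rfl⟩ := List.mem_map.1 hy
    rw [List.mem_range] at hk
    rw [sigma_succ (show k < n - 1 by omega)]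
    exact h _ (by simpa using hk)

theorem len_Delta {m : ℕ} (hm : m ≤ n) : 2 * len (Delta n m) = m * m - m := by
  have hprod (m : ℕ) (h : m ≤ n - 1) :
      len ((List.range m).map fun k => sigma n (k + 1)).prod = m := by
    induction m with
    | zero => simp
    | succ m ih => rw [prod_sigma_succ (by omega), len_mul, ih (by omega), len_gen]
  induction m with
  | zero => simp [Delta]
  | succ m ih =>
    have h1 := ih (by omega)
    have h2 : m ≤ m * m := Nat.le_mul_self m
    rw [Delta_succ, len_mul, hprod m (by omega), mul_add, h1]
    have h3 : (m + 1) * (m + 1) = m * m + 2 * m + 1 := by ring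
    omega

theorem perm_prod_sigma_apply {m : ℕ} (hm : m ≤ n - 1) (a : Fin n) :
    (perm ((List.range m).map fun k => sigma n (k + 1)).prod a : ℕ) =
      if (a : ℕ) < m then (a : ℕ) + 1 else if (a : ℕ) = m then 0 else a := by
  induction m generalizing a with
  | zero =>
    simp
  | succ m ih =>
    rw [prod_sigma_succ (by omega), map_mul, perm_gen, Perm.mul_apply, ih (by omega),
      adj_apply_val]
    grind

theorem perm_Delta_apply {m : ℕ} (hm : m ≤ n) (a : Fin n) :
    (perm (Delta n m) a : ℕ) = if (a : ℕ) < m then m - 1 - a else a := by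
  induction m generalizing a with
  | zero => simp [Delta]
  | succ m ih =>
    rw [Delta_succ, map_mul, Perm.mul_apply, perm_prod_sigma_apply (by omega), ih (by omega)]
    split_ifs <;> omega

theorem perm_Delta_inv {m : ℕ} (hm : m ≤ n) : (perm (Delta n m))⁻¹ = perm (Delta n m) := by
  rw [inv_eq_iff_mul_eq_one]
  ext a
  rw [Perm.mul_apply, perm_Delta_apply hm, perm_Delta_apply hm, Perm.one_apply]
  split_ifs <;> omega

theorem mem_inversions_Delta {m : ℕ} (hm : m ≤ n) {a b : Fin n} :
    (a, b) ∈ inversions (perm (Delta n m)) ↔ (a : ℕ) < m ∧ (b : ℕ) < m ∧ a ≠ b := by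
  simp only [mem_inversions, Fin.lt_def, perm_Delta_apply hm, Ne, Fin.ext_iff]
  split_ifs <;> omega

/-- Its permutation reverses the first m positions, so the inversions are the m² - m ordered pairs
of distinct positions among them. -/
theorem reduced_Delta {m : ℕ} (hm : m ≤ n) : Reduced (Delta n m) := by
  have h : inversions (perm (Delta n m)) =
      (Finset.univ.filter fun a : Fin n => (a : ℕ) < m).offDiag := by
    ext ⟨a, b⟩
    simp [mem_inversions_Delta hm]
  have hc : (Finset.univ.filter fun a : Fin n => (a : ℕ) < m).card = m := by
    rw [Fin.card_filter_val_lt, min_eq_right hm]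
  rw [Reduced, h, Finset.offDiag_card, hc, len_Delta hm]

theorem isSimple_iff_reduced {x : PosBraid n} : IsSimple x ↔ Reduced x := by
  constructor
  · rintro ⟨z, hz⟩
    have := reduced_Delta (le_refl n)
    rw [hz] at this
    exact this.of_mul.1
  · intro hx
    -- Every pair crosses in Δ_n, so the required inclusion starts from the empty set.
    refine hx.dvd_of_uncrossed_le (reduced_Delta le_rfl) ?_
    intro a b ⟨h1, h2⟩
    rw [perm_Delta_inv le_rfl, Fin.lt_def, perm_Delta_apply le_rfl, perm_Delta_apply le_rfl] at h2
    rw [Fin.lt_def] at h1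
    split_ifs at h2 <;> omega

theorem gen_dvd_Delta {m : ℕ} (hm : m ≤ n) {i : Fin (n - 1)} (hi' : (i : ℕ) + 1 < m) :
    gen i ∣ Delta n m := by
  have hg : Reduced (gen i) := by rw [Reduced, perm_gen, card_inversions_adj, len_gen]
  refine hg.dvd_of_uncrossed_le (reduced_Delta hm) ?_
  intro a b ⟨h1, h2⟩
  refine ⟨h1, ?_⟩
  rw [perm_Delta_inv hm, Fin.lt_def, perm_Delta_apply hm, perm_Delta_apply hm] at h2
  rw [perm_gen, adj_inv, Fin.lt_def, adj_apply_val, adj_apply_val]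
  rw [Fin.lt_def] at h1
  split_ifs at h2 ⊢ <;> omega

/-- `w` is decreasing on the first `m` positions. -/
def DecreasingBelow (m : ℕ) (w : Perm (Fin n)) : Prop :=
  ∀ a b : Fin n, a < b → (b : ℕ) < m → w b < w a

theorem inversions_Delta_subset_iff {m : ℕ} (hm : m ≤ n) {w : Perm (Fin n)} :
    inversions (perm (Delta n m)) ⊆ inversions w ↔ DecreasingBelow m w := by
  constructor
  · intro h a b hab hb
    have h1 := h ((mem_inversions_Delta hm).2 ⟨lt_trans hab hb, hb, hab.ne⟩)
    have h2 : w a ≠ w b := w.injective.ne hab.ne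
    simp only [mem_inversions, hab, true_iff, not_lt] at h1
    exact lt_of_le_of_ne h1 h2.symm
  · rintro h ⟨a, b⟩ hab
    obtain ⟨h1, h2, h3⟩ := (mem_inversions_Delta hm).1 hab
    rw [mem_inversions]
    rcases lt_or_gt_of_ne h3 with h3 | h3
    · have := h a b h3 h2
      simp [h3, this.le]
    · have := h b a h3 h1
      simp [h3.le, this]

theorem Reduced.rightDivisibleBy_Delta_iff {m : ℕ} (hm : m ≤ n) {x : PosBraid n}
    (hx : Reduced x) : RightDivisibleBy x (Delta n m) ↔ DecreasingBelow m (perm x) := by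
  rw [← inversions_Delta_subset_iff hm]
  constructor
  · rintro ⟨z, rfl⟩
    rw [map_mul]
    exact hx.of_mul.2.2
  · intro h
    obtain ⟨z, hz, hzw⟩ := exists_reduced (perm x * (perm (Delta n m))⁻¹)
    refine ⟨z, hx.eq_of_perm_eq (hz.mul (reduced_Delta hm) ?_) ?_⟩
    · simpa [hzw] using h
    · simp [hzw]

theorem decreasingBelow_of_descents {m : ℕ} {w : Perm (Fin n)}
    (h : ∀ i : Fin (n - 1), (i : ℕ) + 1 < m → w (hi i) < w (lo i)) : DecreasingBelow m w := by
  have key (d : ℕ) : ∀ a b : Fin n, (a : ℕ) + d + 1 = b → (b : ℕ) < m → w b < w a := by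
    induction d with
    | zero =>
      intro a b hab hb
      have h1 := h ⟨a, by omega⟩ (by simp; omega)
      have hb' : b = hi ⟨a, by omega⟩ := Fin.ext (by simp; omega)
      rwa [← hb'] at h1
    | succ d ih =>
      intro a b hab hb
      have h1 := ih a ⟨a + d + 1, by omega⟩ rfl (by simp; omega)
      have h2 := h ⟨a + d + 1, by omega⟩ (by simp; omega)
      have hb' : b = hi ⟨a + d + 1, by omega⟩ := Fin.ext (by simp; omega)
      rw [← hb'] at h2
      exact h2.trans h1
  intro a b hab hb
  exact key (b - a - 1) a b (by rw [Fin.lt_def] at hab; omega) hb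

theorem outer_le_krammer_Delta {m : ℕ} (hm : m ≤ n) :
    (Outer m : Fin n → Fin n → Prop) ≤ krammer (Delta n m) (Outer m) := by
  let S : Submonoid (PosBraid n) :=
    { carrier := {x | (Outer m : Fin n → Fin n → Prop) ≤ krammer x (Outer m)}
      one_mem' := by simp [krammer_one]
      mul_mem' := by
        intro x y hx hy
        change _ ≤ krammer (x * y) _
        rw [krammer_mul]
        exact le_trans hx (krammer_mono x hy) }
  exact Delta_mem S hm fun i hi' => outer_le_krammerGen hi'

/-- A simple braid that divides `x * Δ_m`, where `x` is simple and right divisible by `Δ_m`,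
divides `x`. -/
theorem Reduced.dvd_of_dvd_mul_Delta {m : ℕ} (hm : m ≤ n) {x z : PosBraid n} (hx : Reduced x)
    (hxm : RightDivisibleBy x (Delta n m)) (hz : Reduced z) (h : z ∣ x * Delta n m) : z ∣ x := by
  refine hz.dvd_of_uncrossed_le hx (le_trans ?_ (hz.krammer_le_uncrossed h))
  obtain ⟨y, rfl⟩ := hxm
  rw [← hx.krammer_lt, krammer_mul, krammer_mul, krammer_mul]
  refine krammer_mono y ?_
  have h1 : krammer (Delta n m) (· < ·) ≤ Outer m := by
    rw [(reduced_Delta hm).krammer_lt]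
    intro a b ⟨h1, h2⟩
    refine ⟨h1, ?_⟩
    rw [perm_Delta_inv hm, Fin.lt_def, perm_Delta_apply hm, perm_Delta_apply hm] at h2
    rw [Fin.lt_def] at h1
    split_ifs at h2 <;> omega
  have h2 : (Outer m : Fin n → Fin n → Prop) ≤ (· < ·) := fun a b h => h.1
  have h3 := outer_le_krammer_Delta hm
  -- Δ_m sends the full set into the outer pairs, and these survive any further action of Δ_m; hence
  -- Δ_mΔ_m keeps every pair that Δ_m keeps.
  exact h1.trans (h3.trans (krammer_mono _ (h3.trans (krammer_mono _ h2))))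

theorem isLeftGcd_mul_Delta_iff {m : ℕ} (hm : m ≤ n) {x : PosBraid n} (hx : IsSimple x) :
    IsLeftGcd x (Delta n n) (x * Delta n m) ↔ RightDivisibleBy x (Delta n m) := by
  rw [isSimple_iff_reduced] at hx
  constructor
  · rintro ⟨-, -, h⟩
    rw [hx.rightDivisibleBy_Delta_iff hm]
    refine decreasingBelow_of_descents fun i hi' => ?_
    by_contra hc
    have hlt : perm x (lo i) < perm x (hi i) :=
      lt_of_le_of_ne (not_lt.1 hc) ((perm x).injective.ne (lo_lt_hi i).ne)
    -- An ascent makes xσ_i a simple divisor of xΔ_m, so the gcd property yields a divisor of x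
    -- longer than x.
    have h1 : x * gen i ∣ x :=
      h _ (isSimple_iff_reduced.2 (hx.mul_gen hlt)) (mul_dvd_mul_left x (gen_dvd_Delta hm hi'))
    obtain ⟨y, hy⟩ := h1
    have := congrArg len hy
    simp only [len_mul, len_gen] at this
    omega
  · intro h
    exact ⟨isSimple_iff_reduced.2 hx, dvd_mul_right _ _,
      fun z hz hz' => hx.dvd_of_dvd_mul_Delta hm h (isSimple_iff_reduced.1 hz) hz'⟩

end Garside

/-! ### Counting permutations, then braids. -/

section Counting

/-- The last r values fix the set of the first m values, and a strictly monotone map is determined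
by its range; `Fin.rev` turns decreasing into increasing. -/
theorem eq_of_decreasingBelow {m r : ℕ} {w v : Perm (Fin (m + r))} (hw : DecreasingBelow m w)
    (hv : DecreasingBelow m v) (h : ∀ j : Fin r, w (Fin.natAdd m j) = v (Fin.natAdd m j)) :
    w = v := by
  have mono {u : Perm (Fin (m + r))} (hu : DecreasingBelow m u) :
      StrictMono fun i : Fin m => u (Fin.castAdd r i.rev) := fun i j hij =>
    hu _ _ (by simpa [Fin.lt_def] using Fin.rev_lt_rev.2 hij) i.rev.isLt
  have sub {u v : Perm (Fin (m + r))}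
      (h : ∀ j : Fin r, u (Fin.natAdd m j) = v (Fin.natAdd m j)) :
      (Set.range fun i : Fin m => u (Fin.castAdd r i.rev)) ⊆
        Set.range fun i : Fin m => v (Fin.castAdd r i.rev) := by
    rintro _ ⟨i, rfl⟩
    obtain ⟨c, hc⟩ := v.surjective (u (Fin.castAdd r i.rev))
    induction c using Fin.addCases with
    | left c => exact ⟨c.rev, by simpa using hc⟩
    | right c =>
      rw [← h c] at hc
      have := congrArg Fin.val (u.injective hc)
      simp only [Fin.val_natAdd, Fin.val_castAdd] at this
      omega
  have key := ((mono hw).range_inj (mono hv)).1 ((sub h).antisymm (sub fun j => (h j).symm))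
  refine Equiv.ext fun c => ?_
  induction c using Fin.addCases with
  | left c => simpa using congrFun key c.rev
  | right c => exact h c

theorem exists_decreasingBelow {m r : ℕ} (e : Fin r ↪ Fin (m + r)) :
    ∃ w : Perm (Fin (m + r)), DecreasingBelow m w ∧ ∀ j, w (Fin.natAdd m j) = e j := by
  have hs : ((Finset.univ.map e)ᶜ).card = m := by simp [Finset.card_compl]
  let g := ((Finset.univ.map e)ᶜ).orderEmbOfFin hs
  have hge (i : Fin m) (j : Fin r) : g i ≠ e j := by
    intro h
    have := Finset.orderEmbOfFin_mem _ hs i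
    change g i ∈ _ at this
    simp [h] at this
  have hinj : Function.Injective (Fin.append (fun i => g i.rev) e) := by
    intro a b hab
    induction a using Fin.addCases with
    | left a =>
      induction b using Fin.addCases with
      | left b => simpa using hab
      | right b => exact absurd (by simpa using hab) (hge a.rev b)
    | right a =>
      induction b using Fin.addCases with
      | left b => exact absurd (by simpa using hab.symm) (hge b.rev a)
      | right b => simpa using hab
  refine ⟨Equiv.ofBijective _ (Finite.injective_iff_bijective.1 hinj), ?_, fun j => by simp⟩
  intro a b hab hb
  obtain ⟨b, rfl⟩ : ∃ b' : Fin m, b = Fin.castAdd r b' := ⟨⟨b, hb⟩, rfl⟩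
  obtain ⟨a, rfl⟩ : ∃ a' : Fin m, a = Fin.castAdd r a' := ⟨⟨a, lt_trans hab hb⟩, rfl⟩
  have hab' : a < b := hab
  simpa using hab'

theorem ncard_decreasingBelow {n m r : ℕ} (h : m + r = n) :
    {w : Perm (Fin n) | DecreasingBelow m w}.ncard = n.descFactorial r := by
  subst h
  have hcard : (Set.univ : Set (Fin r ↪ Fin (m + r))).ncard = (m + r).descFactorial r := by
    rw [Set.ncard_univ, Nat.card_eq_fintype_card, Fintype.card_embedding_eq, Fintype.card_fin,
      Fintype.card_fin]
  rw [← hcard]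
  refine Set.ncard_congr (fun w _ => (Fin.natAddEmb m).trans w.toEmbedding) (fun _ _ => trivial) ?_ ?_
  · intro w v hw hv hwv
    exact eq_of_decreasingBelow hw hv fun j => DFunLike.congr_fun hwv j
  · intro e _
    obtain ⟨w, hw, he⟩ := exists_decreasingBelow e
    exact ⟨w, hw, DFunLike.ext _ _ he⟩

variable {n : ℕ}

theorem ncard_simple_rightDivisibleBy_Delta {m r : ℕ} (h : m + r = n) :
    {x : PosBraid n | IsSimple x ∧ RightDivisibleBy x (Delta n m)}.ncard = n.descFactorial r := by
  have hm : m ≤ n := by omega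
  rw [← ncard_decreasingBelow h]
  refine Set.ncard_congr (fun x _ => perm x) ?_ ?_ ?_
  · rintro x ⟨hx, hxm⟩
    exact ((isSimple_iff_reduced.1 hx).rightDivisibleBy_Delta_iff hm).1 hxm
  · rintro x y ⟨hx, -⟩ ⟨hy, -⟩ hxy
    exact (isSimple_iff_reduced.1 hx).eq_of_perm_eq (isSimple_iff_reduced.1 hy) hxy
  · intro w hw
    obtain ⟨x, hx, rfl⟩ := exists_reduced w
    exact ⟨x, ⟨isSimple_iff_reduced.2 hx, (hx.rightDivisibleBy_Delta_iff hm).2 hw⟩, rfl⟩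

theorem prod_map_range_eq_mul {M : Type*} [Monoid M] {s : ℕ → M} (h2 : ∀ k, 2 ≤ k → s k = 1)
    (m : ℕ) (hm : ∀ k, m ≤ k → s k = 1) : ((List.range m).map s).prod = s 0 * s 1 := by
  match m with
  | 0 => simp [hm 0, hm 1]
  | 1 => simp [hm 1]
  | m + 2 =>
    clear hm
    induction m with
    | zero => simp [List.range_succ]
    | succ m ih =>
      rw [List.range_succ, List.map_append, List.prod_append, ih, List.map_singleton,
        List.prod_singleton, h2 (m + 2) (by omega), mul_one]

theorem isSimple_Delta {m : ℕ} (hm : m ≤ n) : IsSimple (Delta n m) :=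
  isSimple_iff_reduced.2 (reduced_Delta hm)

theorem braidsWithFactor_two_Delta {m : ℕ} (hm : m ≤ n) :
    braidsWithFactor n 2 (Delta n m) =
      (fun x => x * Delta n m) ''
        {x : PosBraid n | IsSimple x ∧ RightDivisibleBy x (Delta n m)} := by
  ext y
  constructor
  · rintro ⟨s, ⟨l, ⟨hs, hg⟩, rfl, hl⟩, h2, h1⟩
    change s 1 = _ at h1
    rw [prod_map_range_eq_mul h2 l hl, h1]
    refine ⟨s 0, ?_, rfl⟩
    -- An empty normal sequence carries no gcd condition, but then Δ_m = 1 and divisibility is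
    -- trivial.
    rcases Nat.eq_zero_or_pos l with rfl | hpos
    · rw [hl 0 le_rfl, ← h1, hl 1 (by omega)]
      exact ⟨one_dvd _, 1, by simp⟩
    · have h0 : IsSimple (s 0) := hs _ (List.mem_map.2 ⟨0, List.mem_range.2 hpos, rfl⟩)
      have := hg 0 (by simpa using hpos)
      simp only [List.getElem_map, List.getElem_range, List.drop_zero] at this
      rw [prod_map_range_eq_mul h2 l hl, h1, isLeftGcd_mul_Delta_iff hm h0] at this
      exact ⟨h0, this⟩
  · rintro ⟨x, ⟨hx, hxm⟩, rfl⟩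
    refine ⟨fun k => if k = 0 then x else if k = 1 then Delta n m else 1,
      ⟨2, ⟨?_, ?_⟩, ?_, ?_⟩, ?_, ?_⟩
    · simp [List.range_succ, hx, isSimple_Delta hm]
    · intro k hk
      have hk2 : k < 2 := by simpa using hk
      interval_cases k
      · simpa [List.range_succ] using (isLeftGcd_mul_Delta_iff hm hx).2 hxm
      · have : IsLeftGcd (Delta n m) (Delta n n) (Delta n m) :=
          ⟨isSimple_Delta hm, dvd_rfl, fun z _ h => h⟩
        simpa only [List.range_succ, List.range_zero, List.nil_append, List.map_append,
          List.map_cons, List.map_nil, List.cons_append, List.drop_succ_cons, List.drop_zero,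
          List.prod_cons, List.prod_nil, mul_one, List.getElem_cons_succ, List.getElem_cons_zero,
          one_ne_zero, if_true, if_false] using this
    · simp [List.range_succ]
    · intro k hk
      simp [show k ≠ 0 by omega, show k ≠ 1 by omega]
    · intro k hk
      simp [show k ≠ 0 by omega, show k ≠ 1 by omega]
    · simp

/-- Injectivity of x ↦ xΔ_m needs no cancellation: x is recovered as the gcd of Δ_n and xΔ_m, unique
because divisibility is antisymmetric. -/
theorem b_two_Delta {m : ℕ} (hm : m ≤ n) :
    b n 2 (Delta n m) =
      {x : PosBraid n | IsSimple x ∧ RightDivisibleBy x (Delta n m)}.ncard := by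
  rw [b, braidsWithFactor_two_Delta hm]
  refine Set.InjOn.ncard_image ?_
  rintro x ⟨hx, hxm⟩ y ⟨hy, hym⟩ hxy
  have h1 := (isLeftGcd_mul_Delta_iff hm hx).2 hxm
  have h2 := (isLeftGcd_mul_Delta_iff hm hy).2 hym
  simp only at hxy
  rw [hxy] at h1
  exact dvd_antisymm_posBraid (h2.2.2 x h1.1 h1.2.1) (h1.2.2 y h2.1 h2.2.1)

end Counting

end BraidCount

theorem proposition4p4 (n r : ℕ) (hr : 1 ≤ r) (hrn : r ≤ n) :
    (BraidCount.b n 2 (BraidCount.Delta n (n - r)) : ℚ) = (n ! : ℚ) / ((n - r)! : ℚ) ∧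
      BraidCount.b n 2 (BraidCount.Delta n (n - r)) =
        {x : BraidCount.PosBraid n | BraidCount.IsSimple x ∧
          BraidCount.RightDivisibleBy x (BraidCount.Delta n (n - r))}.ncard := by
  have hb := BraidCount.b_two_Delta (n := n) (m := n - r) (Nat.sub_le n r)
  refine ⟨?_, hb⟩
  rw [hb, BraidCount.ncard_simple_rightDivisibleBy_Delta (Nat.sub_add_cancel hrn),
    eq_div_iff (by exact_mod_cast (Nat.factorial_pos _).ne')]
  rw [mul_comm]
  exact_mod_cast Nat.factorial_mul_descFactorial hrn
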